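/- \textbf{Setting.} A finite set $\mathcal N$ of users, a finite nonempty set $\mathcal T$ of time slots and a finite set $\mathcal L$ of constraints are given, with unit prices $p_t\in\mathbb R$, a peak price $p_0\ge 0$, coefficient vectors $\mathbf a^{i,l}=(a^{i,l}_t)_{t\in\mathcal T}\in\mathbb R^{\mathcal T}$, bounds $b^l\in\mathbb R$, and utility functions $v^i_t:\mathbb R\to\mathbb R$ that are twice differentiable and strictly concave. Put $v^i(\mathbf x^i)=\sum_t v^i_t(x^i_t)$. Assume that the feasible set $$\mathcal X=\Big\{\mathbf x=(\mathbf x^i)_{i\in\mathcal N}:\ \sum_{i}\mathbf a^{i,l}\cdot\mathbf x^i\le b^l\ \ \forall l\in\mathcal L\Big\}$$ is a nonempty polytope (in particular bounded). An \emph{optimal allocation} is a maximizer over $\mathbf x\in\mathcal X$ of $$\sum_i v^i(\mathbf x^i)-\sum_t p_t\sum_i x^i_t-p_0\max_t\sum_i x^i_t .$$ Let $\mathcal{GR}$ be a connected graph on $\mathcal N$ (the message-exchange network), let $G$ be any spanning tree of it, let $\mathcal N(i)$ be the set of neighbours of $i$ in $G$, and let $\phi:\mathcal N\to\mathcal N$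 be any map with $\phi(i)\in\mathcal N(i)$ for all $i$ (the helper of $i$; in particular there are at least two users). \textbf{Mechanism.} User $i$ chooses a message $$m^i=\big(y^i_t,\ q^{i,l},\ s^i_t,\ (\beta^{i,j}_t)_{j:\phi(j)=i},\ (n^{i,j,l})_{j\in\mathcal N(i)},\ (\nu^{i,j}_t)_{j\in\mathcal N(i)}\big)_{t\in\mathcal T,\,l\in\mathcal L}$$ with $q^{i,l},s^i_t\ge 0$ and all other components arbitrary reals. She receives the allocation $\hat x^i_t(m)=y^i_t$ and pays the tax $$\hat t^i(m)=\mathrm{cost}^i+\sum_l\big(\mathrm{pr}n^{i,l}+\mathrm{con}^{i,l}\big)+\sum_t\big(\mathrm{pr}\beta^i_t+\mathrm{pr}\nu^i_t+\mathrm{con}^i_t\big),$$ where \begin{align*} \mathrm{cost}^i&=\sum_t\big(p_t+\mathcal{RP}_t(\mathbf s^{-i},\boldsymbol\zeta^{-i})\big)y^i_t+\sum_{l\in\mathcal L_i}q^{-i,l}\,\mathbf a^{i,l}\cdot\mathbf y^i,\qquad \mathcal L_i=\{l:\mathbf a^{i,l}\ne\mathbf 0\},\\ \mathrm{con}^{i,l}&=(q^{i,l}-q^{-i,l})^2+q^{i,l}\Big(b^l-\sum_{j\in\mathcal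 N(i)}f^{i,j,l}-\mathbf a^{i,l}\cdot\boldsymbol\beta^{\phi(i),i}\Big),\\ \mathrm{con}^i_t&=(s^i_t-s^{-i}_t)^2+s^i_t(z^{-i}-\zeta^{-i}_t),\\ \mathrm{pr}n^{i,l}&=\sum_{j\in\mathcal N(i)}(n^{i,j,l}-f^{i,j,l})^2,\quad \mathrm{pr}\beta^i_t=\sum_{j:\phi(j)=i}(\beta^{i,j}_t-y^j_t)^2,\quad \mathrm{pr}\nu^i_t=\sum_{j\in\mathcal N(i)}(\nu^{i,j}_t-f^{i,j}_t)^2,\\ f^{i,j,l}&=\mathbf a^{j,l}\cdot\mathbf y^j+\sum_{h\in\mathcal N(j)\setminus\{i\}}n^{j,h,l},\qquad f^{i,j}_t=y^j_t+\sum_{h\in\mathcal N(j)\setminus\{i\}}\nu^{j,h}_t,\\ s^{-i}_t&=\frac1{|\mathcal N(i)|}\sum_{j\in\mathcal N(i)}s^j_t,\qquad q^{-i,l}=\frac1{|\mathcal N(i)|}\sum_{j\in\mathcal N(i)}q^{j,l},\\ \zeta^{-i}_t&=\sum_{j\in\mathcal N(i)}f^{i,j}_t+\beta^{\phi(i),i}_t,\qquad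 z^{-i}=\max_t\zeta^{-i}_t , \end{align*} and where $\mathcal{RP}_t(\mathbf s,\mathbf d)=p_0\,s_t/\sum_{t'}s_{t'}$ if $\mathbf s\ne\mathbf 0$, while $\mathcal{RP}_t(\mathbf 0,\mathbf d)$ equals $p_0/\#\arg\max_{t'}d_{t'}$ if $t\in\arg\max_{t'}d_{t'}$ and $0$ otherwise. The payoff of user $i$ in the induced game is $u^i(m)=v^i(\hat{\mathbf x}^i(m))-\hat t^i(m)$. \textbf{Theorem.} There is exactly one optimal allocation. The induced game has a (pure-strategy) Nash equilibrium, and for every Nash equilibrium $m$ the allocation $\hat{\mathbf x}(m)$ is the optimal allocation. -/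

import Mathlib

open scoped BigOperators NNReal

noncomputable section

/-- The data of an energy community: users `ι`, time slots `τ`, linear constraints `κ`.
`a i l t` is the coefficient of the demand of user `i` at time `t` in constraint `l`. -/
structure EnergyCommunity (ι τ κ : Type*) where
  /-- the utility of user `i` for her demand at time `t` -/
  v : ι → τ → ℝ → ℝ
  /-- the unit price at time `t` -/
  price : τ → ℝ
  /-- the unit price for the peak demand -/
  peakPrice : ℝ
  a : ι → κ → τ → ℝ
  b : κ → ℝ

namespace EnergyCommunity

variable {ι τ κ : Type*} [Fintype ι] [Fintype τ] [Nonempty τ] [Fintype κ]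

/-- The maximum of finitely many real numbers. -/
def peak (d : τ → ℝ) : ℝ := Finset.univ.sup' Finset.univ_nonempty d

/-- The utility of user `i` for a demand vector. -/
def utility (E : EnergyCommunity ι τ κ) (i : ι) (x : τ → ℝ) : ℝ := ∑ t, E.v i t (x t)

/-- The cost of energy to the community. -/
def energyCost (E : EnergyCommunity ι τ κ) (x : ι → τ → ℝ) : ℝ :=
  (∑ t, E.price t * ∑ i, x i t) + E.peakPrice * peak (fun t => ∑ i, x i t)

/-- The feasible set. -/
def feasible (E : EnergyCommunity ι τ κ) : Set (ι → τ → ℝ) :=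
  {x | ∀ l, ∑ i, ∑ t, E.a i l t * x i t ≤ E.b l}

/-- Total utility minus cost of energy. -/
def welfare (E : EnergyCommunity ι τ κ) (x : ι → τ → ℝ) : ℝ :=
  (∑ i, E.utility i (x i)) - E.energyCost x

/-- `x` solves the demand management problem. -/
def IsOptimalAllocation (E : EnergyCommunity ι τ κ) (x : ι → τ → ℝ) : Prop :=
  x ∈ E.feasible ∧ ∀ x' ∈ E.feasible, E.welfare x' ≤ E.welfare x

open Classical in
/-- The radial pricing operator. -/
def radialPrice (p₀ : ℝ) (s d : τ → ℝ) (t : τ) : ℝ :=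
  if s ≠ 0 then s t / (∑ t', s t') * p₀
  else if d t = peak d then p₀ / (Finset.univ.filter fun t' => d t' = peak d).card
  else 0

open Classical in
/-- The constraints in which the demand of user `i` occurs. -/
def constraintsOf (E : EnergyCommunity ι τ κ) (i : ι) : Finset κ :=
  Finset.univ.filter fun l => E.a i l ≠ 0

end EnergyCommunity

/-- The message space of user `i` when messages are exchanged along the graph `G` and `φ j` is
the helper of user `j`: demands `y`, nonnegative prices `q` and `s`, the proxies `β j` for the
demands of those `j` whose helper is `i`, and for every neighbour `j` the summaries `n j`, `ν j`
of the demands of the users connected to `i` via `j`. -/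
structure Message {ι : Type*} (G : SimpleGraph ι) (φ : ι → ι) (τ κ : Type*) (i : ι) where
  y : τ → ℝ
  q : κ → ℝ≥0
  s : τ → ℝ≥0
  β : {j : ι // φ j = i} → τ → ℝ
  n : G.neighborSet i → κ → ℝ
  ν : G.neighborSet i → τ → ℝ

/-- Message profiles. -/
abbrev Profile {ι : Type*} (G : SimpleGraph ι) (φ : ι → ι) (τ κ : Type*) : Type _ :=
  (i : ι) → Message G φ τ κ i

namespace Profile

variable {ι τ κ : Type*} [Fintype ι] [DecidableEq ι] [Fintype τ] [Nonempty τ] [Fintype κ]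
variable {G : SimpleGraph ι} [DecidableRel G.Adj] {φ : ι → ι}

/-- Every user is allocated what she demands. -/
def alloc (m : Profile G φ τ κ) (i : ι) (t : τ) : ℝ := (m i).y t

/-- The proxy that the helper of `i` quotes for the demand of `i`. -/
def helperProxy (m : Profile G φ τ κ) (i : ι) (t : τ) : ℝ := (m (φ i)).β ⟨i, rfl⟩ t

/-- `f^{i,j,l}`, for a neighbour `j` of `i`. -/
def fCon (E : EnergyCommunity ι τ κ) (m : Profile G φ τ κ) (i j : ι) (l : κ) : ℝ :=
  (∑ t, E.a j l t * (m j).y t) + ∑ h : G.neighborSet j with h.val ≠ i, (m j).n h l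

/-- `f^{i,j}_t`, for a neighbour `j` of `i`. -/
def fPeak (m : Profile G φ τ κ) (i j : ι) (t : τ) : ℝ :=
  (m j).y t + ∑ h : G.neighborSet j with h.val ≠ i, (m j).ν h t

/-- `s^{-i}_t` -/
def sAvg (m : Profile G φ τ κ) (i : ι) (t : τ) : ℝ :=
  (∑ j ∈ G.neighborFinset i, ((m j).s t : ℝ)) / (G.neighborFinset i).card

/-- `q^{-i,l}` -/
def qAvg (m : Profile G φ τ κ) (i : ι) (l : κ) : ℝ :=
  (∑ j ∈ G.neighborFinset i, ((m j).q l : ℝ)) / (G.neighborFinset i).card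

/-- `ζ^{-i}_t` -/
def zeta (m : Profile G φ τ κ) (i : ι) (t : τ) : ℝ :=
  (∑ j ∈ G.neighborFinset i, m.fPeak i j t) + m.helperProxy i t

/-- `z^{-i}` -/
def zPeak (m : Profile G φ τ κ) (i : ι) : ℝ := EnergyCommunity.peak (m.zeta i)

/-- The payment of user `i` for her allocation. -/
def cost (E : EnergyCommunity ι τ κ) (m : Profile G φ τ κ) (i : ι) : ℝ :=
  ∑ t, (E.price t + EnergyCommunity.radialPrice E.peakPrice (m.sAvg i) (m.zeta i) t) * m.alloc i t
    + ∑ l ∈ E.constraintsOf i, m.qAvg i l * ∑ t, E.a i l t * m.alloc i t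

/-- `con^{i,l}` -/
def conCon (E : EnergyCommunity ι τ κ) (m : Profile G φ τ κ) (i : ι) (l : κ) : ℝ :=
  ((m i).q l - m.qAvg i l) ^ 2
    + (m i).q l * (E.b l - ∑ j ∈ G.neighborFinset i, m.fCon E i j l
        - ∑ t, E.a i l t * m.helperProxy i t)

/-- `con^i_t` -/
def conPeak (m : Profile G φ τ κ) (i : ι) (t : τ) : ℝ :=
  ((m i).s t - m.sAvg i t) ^ 2 + (m i).s t * (m.zPeak i - m.zeta i t)

/-- The penalty for the summaries `n^{i,j,l}`. -/
def prN (E : EnergyCommunity ι τ κ) (m : Profile G φ τ κ) (i : ι) (l : κ) : ℝ :=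
  ∑ j : G.neighborSet i, ((m i).n j l - m.fCon E i j l) ^ 2

/-- The penalty for the proxies `β^{i,j}_t`. -/
def prBeta (m : Profile G φ τ κ) (i : ι) (t : τ) : ℝ :=
  ∑ j : {j : ι // φ j = i}, ((m i).β j t - (m j).y t) ^ 2

/-- The penalty for the summaries `ν^{i,j}_t`. -/
def prNu (m : Profile G φ τ κ) (i : ι) (t : τ) : ℝ :=
  ∑ j : G.neighborSet i, ((m i).ν j t - m.fPeak i j t) ^ 2

/-- The tax of user `i`. -/
def tax (E : EnergyCommunity ι τ κ) (m : Profile G φ τ κ) (i : ι) : ℝ :=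
  m.cost E i + ∑ l, (m.prN E i l + m.conCon E i l)
    + ∑ t, (m.prBeta i t + m.prNu i t + m.conPeak i t)

/-- The payoff of user `i` in the game induced by the mechanism. -/
def payoff (E : EnergyCommunity ι τ κ) (m : Profile G φ τ κ) (i : ι) : ℝ :=
  E.utility i (m.alloc i) - m.tax E i

/-- `m` is a (pure strategy) Nash equilibrium of the induced game. -/
def IsNash (E : EnergyCommunity ι τ κ) (m : Profile G φ τ κ) : Prop :=
  ∀ (i : ι) (mi : Message G φ τ κ i),
    payoff E (Function.update m i mi : Profile G φ τ κ) i ≤ payoff E m i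

end Profile

end

/-! Everything quoted to user `i` comes from her neighbours' messages, so her payoff is her net
utility at fixed prices minus a penalty in her remaining components. The penalty is a sum of
separate quadratics with an explicit unique minimizer, so Nash equilibrium is equivalent to
`IsStationary`.

In a stationary profile the summaries obey a recursion along the directed edges of the tree. By
`IsTree.eq_sum_side` its only solution is the sum over the vertices behind the edge, so all users
are quoted the true slacks and the true total demand. Each `q` and `s` then equals its neighbourhood
average shifted by `-w / 2` and cut off at `0`, with the same slack `w` for all users. By
`Connected.eq_of_eq_max_average` this forces `0 ≤ w` (feasibility), consensus and complementary
slackness. Radial pricing turns the common `s` into weights of total `p₀` on the peak slots, and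
weak duality gives optimality.

Conversely, Farkas' lemma provides multipliers at an optimal allocation, and the profile quoting
them with exact summaries is stationary. The optimum exists by compactness and is unique by strict
concavity. -/

open scoped BigOperators NNReal

/-! ### Farkas' lemma and one-variable inequalities -/

/-- **Farkas' lemma** for finitely many linear inequalities. -/
theorem exists_nonneg_eq_sum_smul_of_forall_nonpos {M J : Type*} [AddCommGroup M] [Module ℝ M]
    (s : Finset J) (g : J → M →ₗ[ℝ] ℝ) (c : M →ₗ[ℝ] ℝ)
    (h : ∀ x, (∀ j ∈ s, g j x ≤ 0) → c x ≤ 0) :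
    ∃ r : J → ℝ, (∀ j, 0 ≤ r j) ∧ c = ∑ j ∈ s, r j • g j := by
  classical
  induction s using Finset.induction_on generalizing g c with
  | empty =>
    refine ⟨0, fun _ => le_rfl, LinearMap.ext fun x => ?_⟩
    have h₁ := h x (by simp)
    have h₂ := h (-x) (by simp)
    rw [map_neg] at h₂
    simpa using le_antisymm h₁ (by linarith)
  | insert k s hk ih =>
    by_cases hs : ∀ x, (∀ j ∈ s, g j x ≤ 0) → c x ≤ 0
    · obtain ⟨r, hr, hc⟩ := ih g c hs
      refine ⟨Function.update r k 0, fun j => ?_, ?_⟩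
      · by_cases hj : j = k
        · simp [hj]
        · simpa [hj] using hr j
      · rw [Finset.sum_insert hk, hc]
        simp only [Function.update_self, zero_smul, zero_add]
        refine Finset.sum_congr rfl fun j hj => ?_
        rw [Function.update_of_ne (by rintro rfl; exact hk hj)]
    · push Not at hs
      obtain ⟨x₁, hx₁, hcx₁⟩ := hs
      have hkx₁ : 0 < g k x₁ := by
        by_contra! hle
        refine absurd (h x₁ fun j hj => ?_) (not_le.2 hcx₁)
        rcases Finset.mem_insert.1 hj with rfl | hj
        exacts [hle, hx₁ j hj]
      -- The normalization `g k x₀ = 1` makes `x ↦ x - g k x • x₀` a projection onto the kernel of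
      -- `g k`. The induction hypothesis is applied to `c` and the `g j` composed with it.
      obtain ⟨x₀, hx₀, hcx₀, hkx₀⟩ : ∃ x₀, (∀ j ∈ s, g j x₀ ≤ 0) ∧ 0 < c x₀ ∧ g k x₀ = 1 := by
        refine ⟨(g k x₁)⁻¹ • x₁, fun j hj => ?_, ?_, ?_⟩
        · simpa using mul_nonpos_of_nonneg_of_nonpos (inv_nonneg.2 hkx₁.le) (hx₁ j hj)
        · simpa using mul_pos (inv_pos.2 hkx₁) hcx₁
        · simp [hkx₁.ne']
      obtain ⟨r, hr, hc⟩ := ih (fun j => g j - g j x₀ • g k) (c - c x₀ • g k) (by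
        intro x hx
        have := h (x - g k x • x₀) (by
          intro j hj
          rcases Finset.mem_insert.1 hj with rfl | hj
          · simp [hkx₀]
          · have := hx j hj
            simp only [LinearMap.sub_apply, LinearMap.smul_apply, smul_eq_mul] at this
            simp only [map_sub, map_smul, smul_eq_mul]
            linarith)
        simp only [map_sub, map_smul, smul_eq_mul] at this
        simp only [LinearMap.sub_apply, LinearMap.smul_apply, smul_eq_mul]
        linarith)
      have hsum : ∑ j ∈ s, r j * g j x₀ ≤ 0 :=
        Finset.sum_nonpos fun j hj => mul_nonpos_of_nonneg_of_nonpos (hr j) (hx₀ j hj)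
      -- The coefficient of `g k` left over when the projection is undone; it is nonnegative because
      -- `c x₀ > 0` and the sum is nonpositive.
      refine ⟨Function.update r k (c x₀ - ∑ j ∈ s, r j * g j x₀), fun j => ?_, ?_⟩
      · by_cases hj : j = k
        · subst hj
          simp only [Function.update_self]
          linarith
        · simpa [hj] using hr j
      · have hupd : ∑ j ∈ s, Function.update r k (c x₀ - ∑ j ∈ s, r j * g j x₀) j • g j
            = ∑ j ∈ s, r j • g j := by
          refine Finset.sum_congr rfl fun j hj => ?_
          rw [Function.update_of_ne (by rintro rfl; exact hk hj)]
        rw [Finset.sum_insert hk, hupd, Function.update_self]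
        ext x
        have := LinearMap.congr_fun hc x
        simp only [LinearMap.sub_apply, LinearMap.smul_apply, smul_eq_mul, LinearMap.sum_apply,
          mul_sub, Finset.sum_sub_distrib, ← mul_assoc, ← Finset.sum_mul] at this
        simp only [LinearMap.add_apply, LinearMap.smul_apply, smul_eq_mul, LinearMap.sum_apply]
        linarith

/-- The graph of a differentiable concave function lies below its tangents. -/
theorem ConcaveOn.le_tangent {f : ℝ → ℝ} (hf : ConcaveOn ℝ Set.univ f)
    (hd : Differentiable ℝ f) (x y : ℝ) : f y ≤ f x + deriv f x * (y - x) := by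
  rcases lt_trichotomy x y with h | rfl | h
  · have := hf.slope_le_deriv (Set.mem_univ x) (Set.mem_univ y) h (hd x)
    rw [slope_def_field, div_le_iff₀ (by linarith)] at this
    linarith
  · simp
  · have := hf.deriv_le_slope (Set.mem_univ y) (Set.mem_univ x) h (hd x)
    rw [slope_def_field, le_div_iff₀ (by linarith)] at this
    linarith

/-- A minimizer of a quadratic on the half line, with quadratic growth. -/
theorem add_sq_le_sq_add_mul {q a w : ℝ} (hq : 0 ≤ q) :
    (max 0 (a - w / 2) - a) ^ 2 + max 0 (a - w / 2) * w + (q - max 0 (a - w / 2)) ^ 2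
      ≤ (q - a) ^ 2 + q * w := by
  -- Equality at an interior minimizer; at the cut-off the two sides differ by `q * (w - 2 * a) ≥
  -- 0`.
  rcases le_total 0 (a - w / 2) with h | h
  · rw [max_eq_right h]; nlinarith
  · rw [max_eq_left h]; nlinarith

/-! ### Averages over neighbours in a connected graph -/

namespace SimpleGraph

variable {ι : Type*} [Fintype ι] [DecidableEq ι] {G : SimpleGraph ι} [DecidableRel G.Adj]

/-- On a connected graph, a function that is nowhere larger than its average over the neighbours
is constant. -/
theorem Connected.eq_of_le_average (hG : G.Connected) {q : ι → ℝ}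
    (h : ∀ i, q i ≤ (∑ j ∈ G.neighborFinset i, q j) / (G.neighborFinset i).card) (i j : ι) :
    q i = q j := by
  have := hG.nonempty
  obtain ⟨k, hk⟩ := Finite.exists_max q
  -- Maximum principle: where the maximum is attained, the average can only keep up if all
  -- neighbours attain it too.
  have step : ∀ i j, G.Adj i j → q i = q k → q j = q k := by
    intro i j hij hi
    by_contra hne
    have hj : j ∈ G.neighborFinset i := by simpa using hij
    have hcard : (0 : ℝ) < (G.neighborFinset i).card := by
      exact_mod_cast Finset.card_pos.2 ⟨j, hj⟩
    have hlt : ∑ j ∈ G.neighborFinset i, q j < ∑ _j ∈ G.neighborFinset i, q k :=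
      Finset.sum_lt_sum (fun j _ => hk j) ⟨j, hj, lt_of_le_of_ne (hk j) hne⟩
    have := h i
    rw [le_div_iff₀ hcard, hi] at this
    rw [Finset.sum_const, nsmul_eq_mul] at hlt
    linarith
  have all : ∀ i, q i = q k := by
    intro i
    obtain ⟨p⟩ := hG.preconnected k i
    suffices ∀ {u v : ι} (p : G.Walk u v), q u = q k → q v = q k from this p rfl
    intro u v p
    induction p with
    | nil => exact id
    | cons hadj _ ih => exact fun hu => ih (step _ _ hadj hu)
  rw [all i, all j]

theorem average_const {q : ι → ℝ} (h : ∀ i j, q i = q j) {i j : ι} (hij : G.Adj i j) :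
    (∑ j ∈ G.neighborFinset i, q j) / (G.neighborFinset i).card = q i := by
  have hcard : ((G.neighborFinset i).card : ℝ) ≠ 0 := by
    have : j ∈ G.neighborFinset i := by simpa using hij
    exact_mod_cast (Finset.card_pos.2 ⟨j, this⟩).ne'
  rw [Finset.sum_congr rfl fun j _ => h j i, Finset.sum_const, nsmul_eq_mul,
    mul_div_cancel_left₀ _ hcard]

/-- If every value is obtained from the average of the neighbours by a shift by `-w / 2` that is
cut off at `0`, then the values agree, `w` is nonnegative and complementary slackness holds. -/
theorem Connected.eq_of_eq_max_average (hG : G.Connected) {q : ι → ℝ} {w : ℝ} {φ : ι → ι}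
    (hφ : ∀ i, G.Adj i (φ i))
    (h : ∀ i, q i
      = max 0 ((∑ j ∈ G.neighborFinset i, q j) / (G.neighborFinset i).card - w / 2)) :
    0 ≤ w ∧ (∀ i j, q i = q j) ∧ ∀ i, q i * w = 0 := by
  have hnonneg : ∀ i, 0 ≤ q i := fun i => by rw [h i]; exact le_max_left _ _
  have hw : 0 ≤ w := by
    -- If `w < 0`, every value is strictly above its average, yet the maximum principle for `-q`
    -- makes `q` constant.
    by_contra! hw
    have hc := hG.eq_of_le_average (q := fun i => -q i) (by
      intro i
      rw [Finset.sum_neg_distrib, neg_div, neg_le_neg_iff]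
      rw [h i]
      exact le_max_of_le_right (by linarith))
    obtain ⟨i⟩ := hG.nonempty
    have havg := average_const (fun i j => neg_injective (hc i j)) (hφ i)
    have := h i
    rw [havg] at this
    have := le_max_right 0 (q i - w / 2)
    linarith
  have hc := hG.eq_of_le_average (q := q) (by
    intro i
    conv_lhs => rw [h i]
    refine max_le (div_nonneg (Finset.sum_nonneg fun j _ => hnonneg j) (Nat.cast_nonneg _)) ?_
    linarith)
  refine ⟨hw, hc, fun i => ?_⟩
  have hi := h i
  rw [average_const hc (hφ i)] at hi
  rcases max_choice 0 (q i - w / 2) with hm | hm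
  · rw [hm] at hi; simp [hi]
  · rw [hm] at hi
    have : w = 0 := by linarith
    simp [this]

/-! ### Sides of the edges of a tree -/

/-- The vertices closer to `j` than to `i`. -/
noncomputable def side (G : SimpleGraph ι) (i j : ι) : Finset ι := {k | G.dist k j < G.dist k i}

theorem mem_side {i j k : ι} : k ∈ G.side i j ↔ G.dist k j < G.dist k i := by
  simp [side]

/-- In a tree, exactly one neighbour of `i` is closer to `k ≠ i` than `i`. -/
theorem IsTree.existsUnique_adj_dist_lt (hG : G.IsTree) {i k : ι} (hik : k ≠ i) :
    ∃! j, G.Adj i j ∧ G.dist k j < G.dist k i := by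
  obtain ⟨p, hp, hpl⟩ := hG.connected.exists_path_of_dist i k
  cases p with
  | nil => exact absurd rfl hik
  | @cons _ j _ hij p =>
    refine ⟨j, ⟨hij, ?_⟩, ?_⟩
    · have := dist_le p
      rw [Walk.length_cons] at hpl
      rw [dist_comm, dist_comm (u := k)]
      omega
    · rintro h ⟨hih, hlt⟩
      -- A geodesic from `h` to `k` avoids `i`, so prefixing `i` gives a second path from `i` to
      -- `k`; paths in a tree are unique, hence their second vertices agree.
      obtain ⟨p', hp', hpl'⟩ := hG.connected.exists_path_of_dist h k
      have hpath : (Walk.cons hih p').IsPath := by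
        rw [Walk.cons_isPath_iff]
        refine ⟨hp', fun hmem => ?_⟩
        have h₁ := dist_le (p'.dropUntil i hmem)
        have h₂ := p'.length_dropUntil_le_length hmem
        rw [dist_comm, dist_comm (u := k)] at hlt
        omega
      have := (hG.isAcyclic.subsingleton_path i k).elim ⟨_, hp⟩ ⟨_, hpath⟩
      have := congrArg (fun q : G.Path i k => q.1.snd) this
      simpa using this.symm

theorem IsTree.eq_biUnion_side (hG : G.IsTree) (i : ι) :
    Finset.univ.erase i = (G.neighborFinset i).biUnion fun j => G.side i j := by
  ext k
  simp only [Finset.mem_erase, Finset.mem_univ, and_true, Finset.mem_biUnion, mem_side,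
    mem_neighborFinset]
  constructor
  · exact fun hk => (hG.existsUnique_adj_dist_lt hk).exists
  · rintro ⟨j, -, hj⟩ rfl
    simp at hj

theorem IsTree.pairwiseDisjoint_side (hG : G.IsTree) (i : ι) :
    Set.PairwiseDisjoint (G.neighborSet i) fun j => G.side i j := by
  intro j hj h hh hjh
  rw [Function.onFun, Finset.disjoint_left]
  intro k hk hk'
  rw [mem_side] at hk hk'
  have hki : k ≠ i := by rintro rfl; simp at hk
  exact hjh ((hG.existsUnique_adj_dist_lt hki).unique ⟨hj, hk⟩ ⟨hh, hk'⟩)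

/-- The whole tree is made up of `i` and the sides of its neighbours. -/
theorem IsTree.sum_side_add (hG : G.IsTree) (c : ι → ℝ) (i : ι) :
    (∑ j ∈ G.neighborFinset i, ∑ k ∈ G.side i j, c k) + c i = ∑ k, c k := by
  rw [← Finset.sum_biUnion (by simpa using hG.pairwiseDisjoint_side i), ← hG.eq_biUnion_side,
    Finset.sum_erase_add _ _ (Finset.mem_univ i)]

/-- A vertex `k ≠ j` has a unique neighbour of `j` closer to it than `j`; this neighbour is not `i`
exactly when `k` lies on the side of `j`, since distances to adjacent vertices differ. -/
theorem IsTree.side_eq (hG : G.IsTree) {i j : ι} (hij : G.Adj i j) :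
    G.side i j = insert j (((G.neighborFinset j).erase i).biUnion fun h => G.side j h) := by
  ext k
  simp only [Finset.mem_insert, Finset.mem_biUnion, Finset.mem_erase, mem_side,
    mem_neighborFinset]
  have hne := hG.dist_ne_of_adj k hij
  constructor
  · intro hk
    by_cases hkj : k = j
    · exact Or.inl hkj
    · obtain ⟨h, hjh, hlt⟩ := (hG.existsUnique_adj_dist_lt hkj).exists
      exact Or.inr ⟨h, ⟨by rintro rfl; omega, hjh⟩, hlt⟩
  · rintro (rfl | ⟨h, ⟨hhi, hjh⟩, hlt⟩)
    · rw [dist_self] at hne ⊢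
      omega
    · have hkj : k ≠ j := by rintro rfl; simp at hlt
      by_contra hk
      exact hhi ((hG.existsUnique_adj_dist_lt hkj).unique ⟨hjh, hlt⟩ ⟨hij.symm, by omega⟩)

theorem IsTree.notMem_biUnion_side (i j : ι) :
    j ∉ ((G.neighborFinset j).erase i).biUnion fun h => G.side j h := by
  simp [mem_side]

theorem sum_neighborSet_ne (i j : ι) (f : ι → ℝ) :
    ∑ h : G.neighborSet j with h.val ≠ i, f h = ∑ h ∈ (G.neighborFinset j).erase i, f h := by
  refine Finset.sum_bij (fun h _ => h.1) ?_ ?_ ?_ ?_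
  · rintro ⟨h, hh⟩ hi
    have : G.Adj j h := hh
    simpa [this] using hi
  · rintro ⟨h, hh⟩ _ ⟨h', hh'⟩ _ heq
    exact Subtype.ext heq
  · intro h hh
    rw [Finset.mem_erase, mem_neighborFinset] at hh
    exact ⟨⟨h, hh.2⟩, by simpa using hh.1, rfl⟩
  · simp

theorem IsTree.sum_side (hG : G.IsTree) (c : ι → ℝ) {i j : ι} (hij : G.Adj i j) :
    ∑ k ∈ G.side i j, c k
      = c j + ∑ h : G.neighborSet j with h.val ≠ i, ∑ k ∈ G.side j h, c k := by
  rw [sum_neighborSet_ne i j fun h => ∑ k ∈ G.side j h, c k, hG.side_eq hij,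
    Finset.sum_insert (IsTree.notMem_biUnion_side i j), Finset.sum_biUnion]
  exact (hG.pairwiseDisjoint_side j).subset (by simp +contextual [Set.subset_def])

/-- Summaries of a tree that satisfy the recursion along the edges are the sums over the sides. -/
theorem IsTree.eq_sum_side (hG : G.IsTree) (c : ι → ℝ) (n : ∀ i, G.neighborSet i → ℝ)
    (hn : ∀ i (j : G.neighborSet i),
      n i j = c j + ∑ h : G.neighborSet j.1 with h.val ≠ i, n j h)
    (i : ι) (j : G.neighborSet i) : n i j = ∑ k ∈ G.side i j, c k := by
  -- The recursion at `(i, j)` only calls sides `G.side j h` with `h ≠ i`; these lie in `G.side i j`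
  -- and miss `j`.
  induction hN : (G.side i j).card using Nat.strong_induction_on generalizing i j with
  | _ N ih =>
    rw [hn, hG.sum_side c j.2]
    congr 1
    refine Finset.sum_congr rfl fun h hh => ih (G.side j h).card ?_ _ h rfl
    rw [← hN]
    refine Finset.card_lt_card ⟨?_, fun hsub => ?_⟩
    · rw [hG.side_eq j.2]
      refine Finset.Subset.trans ?_ (Finset.subset_insert _ _)
      refine Finset.subset_biUnion_of_mem (fun h => G.side j.1 h) ?_
      simpa using ⟨(Finset.mem_filter.1 hh).2, h.2⟩
    · have : j.1 ∈ G.side i j := by rw [hG.side_eq j.2]; exact Finset.mem_insert_self _ _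
      simpa [mem_side] using hsub this

end SimpleGraph
-- Existence and uniqueness of the optimal allocation
namespace EnergyCommunity

section Peak

variable {τ : Type*} [Fintype τ] [Nonempty τ]

theorem le_peak (d : τ → ℝ) (t : τ) : d t ≤ peak d := Finset.le_sup' d (Finset.mem_univ t)

theorem peak_le {d : τ → ℝ} {c : ℝ} (h : ∀ t, d t ≤ c) : peak d ≤ c :=
  Finset.sup'_le _ _ fun t _ => h t

theorem exists_eq_peak (d : τ → ℝ) : ∃ t, d t = peak d := by
  obtain ⟨t, -, ht⟩ := Finset.exists_mem_eq_sup' (Finset.univ_nonempty (α := τ)) d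
  exact ⟨t, ht.symm⟩

theorem continuous_peak : Continuous (peak : (τ → ℝ) → ℝ) :=
  Continuous.finset_sup'_apply _ fun t _ => continuous_apply t

end Peak

variable {ι τ κ : Type*} [Fintype ι] [Fintype τ] [Nonempty τ] [Fintype κ]

theorem continuous_welfare (E : EnergyCommunity ι τ κ) (hv : ∀ i t, Continuous (E.v i t)) :
    Continuous E.welfare := by
  unfold welfare utility energyCost
  refine Continuous.sub ?_ (Continuous.add ?_ (continuous_const.mul ?_))
  · exact continuous_finsetSum _ fun i _ => continuous_finsetSum _ fun t _ =>
      (hv i t).comp (by fun_prop)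
  · fun_prop
  · exact continuous_peak.comp (by fun_prop)

theorem isClosed_feasible (E : EnergyCommunity ι τ κ) : IsClosed E.feasible := by
  unfold feasible
  rw [Set.ofPred_forall]
  exact isClosed_iInter fun l => isClosed_le (by fun_prop) continuous_const

theorem exists_isOptimalAllocation (E : EnergyCommunity ι τ κ)
    (hv : ∀ i t, Continuous (E.v i t)) (hne : E.feasible.Nonempty)
    (hbdd : Bornology.IsBounded E.feasible) : ∃ x, E.IsOptimalAllocation x :=
  (Metric.isCompact_of_isClosed_isBounded E.isClosed_feasible hbdd).exists_isMaxOn hne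
    (E.continuous_welfare hv).continuousOn

/-- The midpoint of two different optima would be feasible and strictly better: the peak is convex,
and strict concavity applies at a coordinate where they differ. -/
theorem IsOptimalAllocation.unique {E : EnergyCommunity ι τ κ}
    (hconc : ∀ i t, StrictConcaveOn ℝ Set.univ (E.v i t)) (hp : 0 ≤ E.peakPrice)
    {x y : ι → τ → ℝ} (hx : E.IsOptimalAllocation x) (hy : E.IsOptimalAllocation y) : x = y := by
  by_contra hne
  obtain ⟨i₀, hi₀⟩ := Function.ne_iff.1 hne
  obtain ⟨t₀, ht₀⟩ := Function.ne_iff.1 hi₀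
  let z : ι → τ → ℝ := fun i t => (1 / 2 : ℝ) * x i t + (1 / 2 : ℝ) * y i t
  have hsum : ∀ t, ∑ i, z i t = 1 / 2 * ∑ i, x i t + 1 / 2 * ∑ i, y i t := fun t => by
    simp only [z, Finset.sum_add_distrib, Finset.mul_sum]
  have hz : z ∈ E.feasible := by
    intro l
    have h₁ := hx.1 l
    have h₂ := hy.1 l
    have : ∑ i, ∑ t, E.a i l t * z i t
        = 1 / 2 * ∑ i, ∑ t, E.a i l t * x i t + 1 / 2 * ∑ i, ∑ t, E.a i l t * y i t := by
      simp only [Finset.mul_sum, ← Finset.sum_add_distrib, z]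
      exact Finset.sum_congr rfl fun i _ => Finset.sum_congr rfl fun t _ => by ring
    linarith
  have hle : ∀ i t, 1 / 2 * E.v i t (x i t) + 1 / 2 * E.v i t (y i t) ≤ E.v i t (z i t) :=
    fun i t => (hconc i t).concaveOn.2 (Set.mem_univ _) (Set.mem_univ _)
      (by norm_num) (by norm_num) (by norm_num)
  have hlt : 1 / 2 * E.v i₀ t₀ (x i₀ t₀) + 1 / 2 * E.v i₀ t₀ (y i₀ t₀) < E.v i₀ t₀ (z i₀ t₀) :=
    (hconc i₀ t₀).2 (Set.mem_univ _) (Set.mem_univ _) ht₀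
      (by norm_num) (by norm_num) (by norm_num)
  have hutil : 1 / 2 * (∑ i, E.utility i (x i)) + 1 / 2 * (∑ i, E.utility i (y i))
      < ∑ i, E.utility i (z i) := by
    simp only [utility, Finset.mul_sum, ← Finset.sum_add_distrib]
    exact Finset.sum_lt_sum (fun i _ => Finset.sum_le_sum fun t _ => hle i t)
      ⟨i₀, Finset.mem_univ _, Finset.sum_lt_sum (fun t _ => hle i₀ t) ⟨t₀, Finset.mem_univ _, hlt⟩⟩
  have hpeak : peak (fun t => ∑ i, z i t)
      ≤ 1 / 2 * peak (fun t => ∑ i, x i t) + 1 / 2 * peak (fun t => ∑ i, y i t) := by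
    refine peak_le fun t => ?_
    rw [hsum]
    have h₁ := le_peak (fun t => ∑ i, x i t) t
    have h₂ := le_peak (fun t => ∑ i, y i t) t
    linarith
  have hcost : E.energyCost z ≤ 1 / 2 * E.energyCost x + 1 / 2 * E.energyCost y := by
    have h₁ : ∑ t, E.price t * ∑ i, z i t = 1 / 2 * (∑ t, E.price t * ∑ i, x i t)
        + 1 / 2 * ∑ t, E.price t * ∑ i, y i t := by
      simp only [hsum, Finset.mul_sum (s := (Finset.univ : Finset τ)), ← Finset.sum_add_distrib]
      exact Finset.sum_congr rfl fun t _ => by ring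
    have h₂ := mul_le_mul_of_nonneg_left hpeak hp
    simp only [energyCost]
    rw [h₁]
    linarith
  have h₁ := hx.2 z hz
  have h₂ := hy.2 z hz
  simp only [welfare] at h₁ h₂
  linarith

/-! ### Karush-Kuhn-Tucker conditions -/

/-- Multipliers `q` of the constraints and `s` of the peak, with which `x` satisfies the
Karush-Kuhn-Tucker conditions. -/
structure IsKKT (E : EnergyCommunity ι τ κ) (x : ι → τ → ℝ) (q : κ → ℝ) (s : τ → ℝ) : Prop where
  q_nonneg : ∀ l, 0 ≤ q l
  s_nonneg : ∀ t, 0 ≤ s t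
  q_slack : ∀ l, q l * (E.b l - ∑ i, ∑ t, E.a i l t * x i t) = 0
  s_slack : ∀ t, s t * (peak (fun t => ∑ i, x i t) - ∑ i, x i t) = 0
  sum_s : ∑ t, s t = E.peakPrice
  deriv_eq : ∀ i t, deriv (E.v i t) (x i t) = E.price t + s t + ∑ l, q l * E.a i l t

/-- For small steps, a direction that does not increase the active constraints stays feasible. -/
theorem eventually_add_mul_le {A B α β : ℝ} (h : A ≤ B) (hact : A = B → α ≤ β) :
    ∀ᶠ ε in nhdsWithin (0 : ℝ) (Set.Ioi 0), A + ε * α ≤ B + ε * β := by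
  rcases h.eq_or_lt with heq | hlt
  · filter_upwards [self_mem_nhdsWithin] with ε hε
    have := mul_le_mul_of_nonneg_left (hact heq) (le_of_lt hε)
    linarith
  · refine Filter.Eventually.filter_mono nhdsWithin_le_nhds ?_
    have h₁ : ContinuousAt (fun ε : ℝ => A + ε * α) 0 := by fun_prop
    have h₂ : ContinuousAt (fun ε : ℝ => B + ε * β) 0 := by fun_prop
    exact (h₁.eventually_lt h₂ (by simpa using hlt)).mono fun ε hε => hε.le

/-- At an optimal allocation, the directional derivative of the objective in epigraph form is
nonpositive along the directions that do not increase the active constraints. -/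
theorem IsOptimalAllocation.directional_le {E : EnergyCommunity ι τ κ}
    (hv : ∀ i t, Differentiable ℝ (E.v i t)) (hp : 0 ≤ E.peakPrice) {x : ι → τ → ℝ}
    (hx : E.IsOptimalAllocation x) (δ : ι → τ → ℝ) (z : ℝ)
    (hcon : ∀ l, ∑ i, ∑ t, E.a i l t * x i t = E.b l → ∑ i, ∑ t, E.a i l t * δ i t ≤ 0)
    (hpk : ∀ t, ∑ i, x i t = peak (fun t => ∑ i, x i t) → ∑ i, δ i t ≤ z) :
    ∑ i, ∑ t, (deriv (E.v i t) (x i t) - E.price t) * δ i t - E.peakPrice * z ≤ 0 := by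
  -- The objective along the ray with the peak replaced by its upper bound `peak + ε * z`, up to a
  -- constant. This is differentiable although the peak is not.
  let F : ℝ → ℝ := fun ε =>
    ∑ i, ∑ t, (E.v i t (x i t + ε * δ i t) - E.price t * (x i t + ε * δ i t))
      - E.peakPrice * (ε * z)
  have hF : HasDerivAt F
      (∑ i, ∑ t, (deriv (E.v i t) (x i t) - E.price t) * δ i t - E.peakPrice * z) 0 := by
    refine HasDerivAt.sub (HasDerivAt.fun_sum fun i _ => HasDerivAt.fun_sum fun t _ => ?_) ?_
    · have hlin : HasDerivAt (fun ε : ℝ => x i t + ε * δ i t) (δ i t) 0 := by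
        simpa using ((hasDerivAt_id (0 : ℝ)).mul_const (δ i t)).const_add (x i t)
      have hvd : HasDerivAt (E.v i t) (deriv (E.v i t) (x i t)) (x i t + 0 * δ i t) := by
        simpa using (hv i t (x i t)).hasDerivAt
      rw [sub_mul]
      exact (hvd.comp (0 : ℝ) hlin).sub (hlin.const_mul _)
    · simpa using ((hasDerivAt_id (0 : ℝ)).mul_const z).const_mul E.peakPrice
  have hle : ∀ᶠ ε in nhdsWithin (0 : ℝ) (Set.Ioi 0), F ε ≤ F 0 := by
    have h₁ : ∀ᶠ ε in nhdsWithin (0 : ℝ) (Set.Ioi 0), ∀ l,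
        ∑ i, ∑ t, E.a i l t * x i t + ε * ∑ i, ∑ t, E.a i l t * δ i t ≤ E.b l + ε * 0 :=
      Filter.eventually_all.2 fun l => eventually_add_mul_le (hx.1 l) (hcon l)
    have h₂ : ∀ᶠ ε in nhdsWithin (0 : ℝ) (Set.Ioi 0), ∀ t,
        ∑ i, x i t + ε * ∑ i, δ i t ≤ peak (fun t => ∑ i, x i t) + ε * z :=
      Filter.eventually_all.2 fun t =>
        eventually_add_mul_le (le_peak (fun t => ∑ i, x i t) t) (hpk t)
    filter_upwards [h₁, h₂] with ε hε₁ hε₂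
    have hfeas : (fun i t => x i t + ε * δ i t) ∈ E.feasible := by
      intro l
      have := hε₁ l
      simp only [Finset.mul_sum, ← Finset.sum_add_distrib, mul_zero, add_zero] at this
      refine le_trans (le_of_eq ?_) this
      exact Finset.sum_congr rfl fun i _ => Finset.sum_congr rfl fun t _ => by ring
    have hpeak : peak (fun t => ∑ i, (x i t + ε * δ i t))
        ≤ peak (fun t => ∑ i, x i t) + ε * z := by
      refine peak_le fun t => ?_
      simpa only [Finset.sum_add_distrib, Finset.mul_sum] using hε₂ t
    have hw := hx.2 _ hfeas
    have hpeak' := mul_le_mul_of_nonneg_left hpeak hp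
    have hcomm : ∀ y : ι → τ → ℝ, ∑ i, ∑ t, (E.v i t (y i t) - E.price t * y i t)
        = ∑ i, E.utility i (y i) - ∑ t, E.price t * ∑ i, y i t := by
      intro y
      simp only [Finset.sum_sub_distrib, utility, Finset.mul_sum]
      rw [Finset.sum_comm (f := fun i t => E.price t * y i t)]
    simp only [welfare, energyCost] at hw
    simp only [F, zero_mul, add_zero, mul_zero, sub_zero]
    rw [hcomm x, hcomm fun i t => x i t + ε * δ i t]
    linarith
  refine le_of_tendsto hF.tendsto_slope_zero_right ?_
  filter_upwards [hle, self_mem_nhdsWithin] with ε hε hpos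
  rw [zero_add, smul_eq_mul]
  exact mul_nonpos_of_nonneg_of_nonpos (inv_nonneg.2 (le_of_lt hpos)) (sub_nonpos.2 hε)

/-- Farkas' lemma in the variables `(δ, z)`, applied to the active constraints and peak slots. As
these are linear, no constraint qualification is needed. -/
theorem IsOptimalAllocation.exists_isKKT {E : EnergyCommunity ι τ κ}
    (hv : ∀ i t, Differentiable ℝ (E.v i t)) (hp : 0 ≤ E.peakPrice) {x : ι → τ → ℝ}
    (hx : E.IsOptimalAllocation x) : ∃ q s, E.IsKKT x q s := by
  classical
  let ev : ι → τ → ((ι → τ → ℝ) × ℝ) →ₗ[ℝ] ℝ := fun i t =>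
    LinearMap.proj t ∘ₗ LinearMap.proj i ∘ₗ LinearMap.fst ℝ (ι → τ → ℝ) ℝ
  let snd : ((ι → τ → ℝ) × ℝ) →ₗ[ℝ] ℝ := LinearMap.snd ℝ (ι → τ → ℝ) ℝ
  have hev : ∀ i t (y : (ι → τ → ℝ) × ℝ), ev i t y = y.1 i t := fun _ _ _ => rfl
  have hsnd : ∀ y : (ι → τ → ℝ) × ℝ, snd y = y.2 := fun _ => rfl
  let g : κ ⊕ τ → ((ι → τ → ℝ) × ℝ) →ₗ[ℝ] ℝ :=
    Sum.elim (fun l => ∑ i, ∑ t, E.a i l t • ev i t) (fun t => ∑ i, ev i t - snd)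
  let c : ((ι → τ → ℝ) × ℝ) →ₗ[ℝ] ℝ :=
    ∑ i, ∑ t, (deriv (E.v i t) (x i t) - E.price t) • ev i t - E.peakPrice • snd
  let P : κ ⊕ τ → Prop := Sum.elim (fun l => ∑ i, ∑ t, E.a i l t * x i t = E.b l)
    (fun t => ∑ i, x i t = peak (fun t => ∑ i, x i t))
  obtain ⟨r, hr, hc⟩ := exists_nonneg_eq_sum_smul_of_forall_nonpos
    (Finset.univ.filter P) g c (by
      rintro ⟨δ, z⟩ h
      have := hx.directional_le hv hp δ z (fun l hl => by
          simpa [g, LinearMap.sum_apply, hev] using h (Sum.inl l) (by simpa [P] using hl))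
        (fun t ht => by
          simpa [g, LinearMap.sum_apply, hev, hsnd] using h (Sum.inr t) (by simpa [P] using ht))
      simpa [c, LinearMap.sum_apply, hev, hsnd] using this)
  -- Extension by zero to the inactive indices is complementary slackness.
  obtain ⟨r', hr'⟩ : ∃ r' : κ ⊕ τ → ℝ, ∀ j, r' j = if P j then r j else 0 := ⟨_, fun _ => rfl⟩
  have hc' : c = ∑ l, r' (Sum.inl l) • g (Sum.inl l) + ∑ t, r' (Sum.inr t) • g (Sum.inr t) := by
    rw [hc, Finset.sum_filter, Fintype.sum_sum_type]
    simp only [hr', ite_smul, zero_smul]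
    rfl
  refine ⟨fun l => r' (Sum.inl l), fun t => r' (Sum.inr t), ?_, ?_, ?_, ?_, ?_, ?_⟩
  · intro l
    rw [hr']
    split_ifs
    exacts [hr _, le_rfl]
  · intro t
    rw [hr']
    split_ifs
    exacts [hr _, le_rfl]
  · intro l
    rw [hr']
    split_ifs with h
    · have : ∑ i, ∑ t, E.a i l t * x i t = E.b l := h
      simp [this]
    · simp
  · intro t
    rw [hr']
    split_ifs with h
    · have : ∑ i, x i t = peak (fun t => ∑ i, x i t) := h
      rw [this]; simp
    · simp
  -- Comparing coefficients of the epigraph variable `z` gives the total of `s`.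
  · have := LinearMap.congr_fun hc' (0, 1)
    simp [c, g, LinearMap.sum_apply, hev, hsnd] at this
    linarith
  · intro i t
    have := LinearMap.congr_fun hc' (Pi.single i (Pi.single t 1), 0)
    simp [c, g, LinearMap.sum_apply, hev, hsnd, Pi.single_apply, ite_apply] at this
    linarith

end EnergyCommunity

/-! ### Radial prices and weak duality -/

namespace EnergyCommunity

variable {ι τ κ : Type*} [Fintype ι] [Fintype τ] [Nonempty τ] [Fintype κ]

theorem sum_constraintsOf (E : EnergyCommunity ι τ κ) (i : ι) (q : κ → ℝ) (y : τ → ℝ) :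
    ∑ l ∈ E.constraintsOf i, q l * ∑ t, E.a i l t * y t
      = ∑ l, q l * ∑ t, E.a i l t * y t := by
  refine Finset.sum_subset (Finset.subset_univ _) fun l _ hl => ?_
  have : E.a i l = 0 := by simpa [constraintsOf] using hl
  simp [this]

theorem radialPrice_nonneg {p : ℝ} (hp : 0 ≤ p) {s : τ → ℝ} (hs : ∀ t, 0 ≤ s t) (d : τ → ℝ)
    (t : τ) : 0 ≤ radialPrice p s d t := by
  unfold radialPrice
  split_ifs
  · exact mul_nonneg (div_nonneg (hs t) (Finset.sum_nonneg fun t _ => hs t)) hp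
  · positivity
  · exact le_rfl

theorem sum_radialPrice (p : ℝ) {s : τ → ℝ} (hs : ∀ t, 0 ≤ s t) (d : τ → ℝ) :
    ∑ t, radialPrice p s d t = p := by
  classical
  unfold radialPrice
  split_ifs with h
  · rw [← Finset.sum_mul, ← Finset.sum_div, div_self, one_mul]
    intro h0
    refine h (funext fun t => ?_)
    exact (Finset.sum_eq_zero_iff_of_nonneg fun t _ => hs t).1 h0 t (Finset.mem_univ t)
  · rw [← Finset.sum_filter, Finset.sum_const, nsmul_eq_mul]
    obtain ⟨t, ht⟩ := exists_eq_peak d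
    have : ((Finset.univ.filter fun t' => d t' = peak d).card : ℝ) ≠ 0 := by
      have : t ∈ Finset.univ.filter fun t' => d t' = peak d := by simpa using ht
      exact_mod_cast (Finset.card_pos.2 ⟨t, this⟩).ne'
    convert mul_div_cancel₀ p this

/-- The radial prices are supported on the peak when `s` is. -/
theorem radialPrice_mul_slack (p : ℝ) {s d : τ → ℝ} (hs : ∀ t, s t * (peak d - d t) = 0) (t : τ) :
    radialPrice p s d t * (peak d - d t) = 0 := by
  unfold radialPrice
  split_ifs with h h'
  · have := hs t
    rw [div_mul_eq_mul_div, div_mul_eq_mul_div, mul_right_comm, this]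
    simp
  · simp [h']
  · simp

/-- Multipliers with total `p` need no rescaling; if they all vanish, then `p = 0` and the default
branch vanishes too. -/
theorem radialPrice_eq_self {p : ℝ} {s : τ → ℝ} (hs : ∀ t, 0 ≤ s t) (hp : ∑ t, s t = p)
    (d : τ → ℝ) (t : τ) : radialPrice p s d t = s t := by
  by_cases h : s = 0
  · have : p = 0 := by rw [← hp, h]; simp
    simp [radialPrice, h, this]
  · have hne : p ≠ 0 := by
      rintro rfl
      exact h (funext fun t =>
        (Finset.sum_eq_zero_iff_of_nonneg fun t _ => hs t).1 hp t (Finset.mem_univ t))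
    simp [radialPrice, h, hp, hne]

/-- What user `i` retains from the demand `y` when the time slots are priced by `r` and the
constraints by `q`. -/
noncomputable def netUtility (E : EnergyCommunity ι τ κ) (i : ι) (q : κ → ℝ) (r : τ → ℝ) (y : τ → ℝ) : ℝ :=
  E.utility i y - (∑ t, (E.price t + r t) * y t + ∑ l, q l * ∑ t, E.a i l t * y t)

theorem sum_netUtility (E : EnergyCommunity ι τ κ) (q : κ → ℝ) (r : τ → ℝ) (x : ι → τ → ℝ) :
    ∑ i, E.netUtility i q r (x i) = ∑ i, E.utility i (x i) - ∑ t, E.price t * ∑ i, x i t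
      - ∑ t, r t * ∑ i, x i t - ∑ l, q l * ∑ i, ∑ t, E.a i l t * x i t := by
  simp only [netUtility, Finset.sum_sub_distrib, Finset.sum_add_distrib, add_mul]
  rw [Finset.sum_comm (f := fun i t => E.price t * x i t),
    Finset.sum_comm (f := fun i t => r t * x i t),
    Finset.sum_comm (f := fun i l => q l * ∑ t, E.a i l t * x i t)]
  simp only [← Finset.mul_sum]
  ring

/-- Weak duality: an allocation in which every user maximizes her net utility at prices that
satisfy complementary slackness is optimal. -/
theorem isOptimalAllocation_of_prices {E : EnergyCommunity ι τ κ} {x : ι → τ → ℝ} {q : κ → ℝ}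
    {r : τ → ℝ} (hx : x ∈ E.feasible) (hq : ∀ l, 0 ≤ q l) (hr : ∀ t, 0 ≤ r t)
    (hq_slack : ∀ l, q l * (E.b l - ∑ i, ∑ t, E.a i l t * x i t) = 0)
    (hr_slack : ∀ t, r t * (peak (fun t => ∑ i, x i t) - ∑ i, x i t) = 0)
    (hsum : ∑ t, r t = E.peakPrice)
    (hmax : ∀ i y, E.netUtility i q r y ≤ E.netUtility i q r (x i)) :
    E.IsOptimalAllocation x := by
  refine ⟨hx, fun x' hx' => ?_⟩
  have hle : ∑ i, E.netUtility i q r (x' i) ≤ ∑ i, E.netUtility i q r (x i) :=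
    Finset.sum_le_sum fun i _ => hmax i (x' i)
  rw [sum_netUtility, sum_netUtility] at hle
  have h₁ : ∑ l, q l * ∑ i, ∑ t, E.a i l t * x' i t ≤ ∑ l, q l * ∑ i, ∑ t, E.a i l t * x i t := by
    refine Finset.sum_le_sum fun l _ => ?_
    have h₂ := mul_le_mul_of_nonneg_left (hx' l) (hq l)
    have h₃ := hq_slack l
    rw [mul_sub] at h₃
    linarith
  -- Nonnegative prices of total `p₀` charge at most `p₀` times the peak, with equality at `x`
  -- because they live on its peak slots.
  have h₂ : ∑ t, r t * ∑ i, x' i t ≤ E.peakPrice * peak (fun t => ∑ i, x' i t) := by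
    rw [← hsum, Finset.sum_mul]
    exact Finset.sum_le_sum fun t _ =>
      mul_le_mul_of_nonneg_left (le_peak (fun t => ∑ i, x' i t) t) (hr t)
  have h₃ : ∑ t, r t * ∑ i, x i t = E.peakPrice * peak (fun t => ∑ i, x i t) := by
    rw [← hsum, Finset.sum_mul]
    refine Finset.sum_congr rfl fun t _ => ?_
    have := hr_slack t
    rw [mul_sub] at this
    linarith
  simp only [welfare, energyCost]
  linarith

/-- Stationarity turns the linear charges into `deriv v (x) * y`, so the tangent inequality applies
slot by slot. -/
theorem IsKKT.netUtility_le {E : EnergyCommunity ι τ κ}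
    (hv : ∀ i t, Differentiable ℝ (E.v i t)) (hconc : ∀ i t, ConcaveOn ℝ Set.univ (E.v i t))
    {x : ι → τ → ℝ} {q : κ → ℝ} {s : τ → ℝ} (h : E.IsKKT x q s) (i : ι) (y : τ → ℝ) :
    E.netUtility i q s y ≤ E.netUtility i q s (x i) := by
  have hlin : ∀ y : τ → ℝ, E.netUtility i q s y
      = ∑ t, (E.v i t (y t) - deriv (E.v i t) (x i t) * y t) := by
    intro y
    simp only [netUtility, utility, h.deriv_eq, Finset.mul_sum]
    rw [Finset.sum_comm, ← Finset.sum_add_distrib, ← Finset.sum_sub_distrib]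
    refine Finset.sum_congr rfl fun t _ => ?_
    rw [add_mul _ (∑ l, q l * E.a i l t), Finset.sum_mul]
    simp only [mul_assoc]
  rw [hlin, hlin]
  refine Finset.sum_le_sum fun t _ => ?_
  have := (hconc i t).le_tangent (hv i t) (x i t) (y t)
  linarith

end EnergyCommunity

/-! ### Best replies and Nash equilibria -/

namespace Profile

open EnergyCommunity

variable {ι τ κ : Type*} [Fintype ι] [DecidableEq ι] [Fintype τ] [Nonempty τ] [Fintype κ]
variable {G : SimpleGraph ι} [DecidableRel G.Adj] {φ : ι → ι}

/-- The slack of constraint `l` as quoted to user `i`. -/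
noncomputable def slack (E : EnergyCommunity ι τ κ) (m : Profile G φ τ κ) (i : ι) (l : κ) : ℝ :=
  E.b l - ∑ j ∈ G.neighborFinset i, m.fCon E i j l - ∑ t, E.a i l t * m.helperProxy i t

/-- The radial prices quoted to user `i`. -/
noncomputable def quotedPrice (E : EnergyCommunity ι τ κ) (m : Profile G φ τ κ) (i : ι) : τ → ℝ :=
  radialPrice E.peakPrice (m.sAvg i) (m.zeta i)

/-- The part of the tax of user `i` with the message `mi` that does not depend on her demand, when
the other users send `m`. -/
noncomputable def penalty (E : EnergyCommunity ι τ κ) (m : Profile G φ τ κ) (i : ι) (mi : Message G φ τ κ i) :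
    ℝ :=
  ∑ l, (∑ j : G.neighborSet i, (mi.n j l - m.fCon E i j l) ^ 2
      + ((mi.q l - m.qAvg i l) ^ 2 + mi.q l * m.slack E i l))
    + ∑ t, (∑ j : {j : ι // φ j = i}, (mi.β j t - (m j).y t) ^ 2
      + ∑ j : G.neighborSet i, (mi.ν j t - m.fPeak i j t) ^ 2
      + ((mi.s t - m.sAvg i t) ^ 2 + mi.s t * (m.zPeak i - m.zeta i t)))

theorem payoff_eq (E : EnergyCommunity ι τ κ) (m : Profile G φ τ κ) (i : ι) :
    m.payoff E i = E.netUtility i (m.qAvg i) (m.quotedPrice E i) (m i).y - m.penalty E i (m i) := by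
  have halloc : m.alloc i = (m i).y := rfl
  simp only [payoff, tax, cost, netUtility, sum_constraintsOf, penalty, prN, conCon, prBeta, prNu,
    conPeak, slack, quotedPrice, halloc]
  ring

/-- All quoted quantities involve only the messages of neighbours. The helper is a neighbour, hence
not `i`, and nobody is her own helper, so `β` is also compared with others' demands. -/
theorem payoff_update (hφ : ∀ i, φ i ∈ G.neighborSet i) (E : EnergyCommunity ι τ κ)
    (m : Profile G φ τ κ) (i : ι) (mi : Message G φ τ κ i) :
    payoff E (Function.update m i mi : Profile G φ τ κ) i
      = E.netUtility i (m.qAvg i) (m.quotedPrice E i) mi.y - m.penalty E i mi := by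
  have hne : ∀ j ∈ G.neighborFinset i, j ≠ i := fun j hj =>
    (G.ne_of_adj (by simpa using hj)).symm
  have hne' : ∀ j : G.neighborSet i, j.1 ≠ i := fun j => (G.ne_of_adj j.2).symm
  have hupd : ∀ j ≠ i, (Function.update m i mi : Profile G φ τ κ) j = m j := fun j hj =>
    Function.update_of_ne hj _ _
  have hfCon : ∀ j ≠ i, ∀ l, fCon E (Function.update m i mi : Profile G φ τ κ) i j l
      = m.fCon E i j l := fun j hj l => by
    unfold fCon; rw [hupd j hj]
  have hfPeak : ∀ j ≠ i, ∀ t, fPeak (Function.update m i mi : Profile G φ τ κ) i j t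
      = m.fPeak i j t := fun j hj t => by
    unfold fPeak; rw [hupd j hj]
  have hproxy : helperProxy (Function.update m i mi : Profile G φ τ κ) i = m.helperProxy i := by
    funext t
    unfold helperProxy
    rw [hupd _ (hne (φ i) (by simpa using hφ i))]
  have hs : sAvg (Function.update m i mi : Profile G φ τ κ) i = m.sAvg i := by
    funext t
    unfold sAvg
    rw [Finset.sum_congr rfl fun j hj => by rw [hupd j (hne j hj)]]
  have hq : qAvg (Function.update m i mi : Profile G φ τ κ) i = m.qAvg i := by
    funext l
    unfold qAvg
    rw [Finset.sum_congr rfl fun j hj => by rw [hupd j (hne j hj)]]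
  have hzeta : zeta (Function.update m i mi : Profile G φ τ κ) i = m.zeta i := by
    funext t
    unfold zeta
    rw [hproxy, Finset.sum_congr rfl fun j hj => hfPeak j (hne j hj) t]
  have hz : zPeak (Function.update m i mi : Profile G φ τ κ) i = m.zPeak i := by
    unfold zPeak; rw [hzeta]
  have hslack : slack E (Function.update m i mi : Profile G φ τ κ) i = m.slack E i := by
    funext l
    unfold slack
    rw [hproxy, Finset.sum_congr rfl fun j hj => hfCon j (hne j hj) l]
  have hβ : ∀ j : {j : ι // φ j = i}, (Function.update m i mi : Profile G φ τ κ) j.1 = m j.1 :=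
    fun j => hupd _ fun h => by
      have := hφ j.1
      rw [j.2, h] at this
      exact G.irrefl this
  rw [payoff_eq]
  simp only [penalty, quotedPrice, hs, hq, hzeta, hz, hslack, hβ, hfCon _ (hne' _),
    hfPeak _ (hne' _), Function.update_self]

/-- The best reply of user `i` that keeps her demand. -/
noncomputable def reply (E : EnergyCommunity ι τ κ) (m : Profile G φ τ κ) (i : ι) : Message G φ τ κ i where
  y := (m i).y
  q l := (max 0 (m.qAvg i l - m.slack E i l / 2)).toNNReal
  s t := (max 0 (m.sAvg i t - (m.zPeak i - m.zeta i t) / 2)).toNNReal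
  β j := (m j).y
  n j := m.fCon E i j
  ν j := m.fPeak i j

/-- Quadratic growth of the penalty around its minimizer: a deviation to `reply` gains at least the
squared distance to it, which must therefore vanish in equilibrium. -/
theorem penalty_reply_add_le (E : EnergyCommunity ι τ κ) (m : Profile G φ τ κ) (i : ι)
    (mi : Message G φ τ κ i) :
    m.penalty E i (m.reply E i)
      + (∑ l, (∑ j : G.neighborSet i, (mi.n j l - m.fCon E i j l) ^ 2
          + ((mi.q l : ℝ) - (m.reply E i).q l) ^ 2)
        + ∑ t, (∑ j : {j : ι // φ j = i}, (mi.β j t - (m j).y t) ^ 2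
          + ∑ j : G.neighborSet i, (mi.ν j t - m.fPeak i j t) ^ 2
          + ((mi.s t : ℝ) - (m.reply E i).s t) ^ 2))
      ≤ m.penalty E i mi := by
  have hq := fun l => add_sq_le_sq_add_mul (a := m.qAvg i l) (w := m.slack E i l) (mi.q l).2
  have hs := fun t => add_sq_le_sq_add_mul (a := m.sAvg i t) (w := m.zPeak i - m.zeta i t)
    (mi.s t).2
  simp only [NNReal.val_eq_coe] at hq hs
  simp only [penalty, reply, Real.coe_toNNReal _ (le_max_left _ _), sub_self, ne_eq,
    OfNat.ofNat_ne_zero, not_false_eq_true, zero_pow, Finset.sum_const_zero, zero_add]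
  have h₁ := Finset.sum_le_sum fun l (_ : l ∈ Finset.univ) => hq l
  have h₂ := Finset.sum_le_sum fun t (_ : t ∈ Finset.univ) => hs t
  simp only [Finset.sum_add_distrib] at h₁ h₂ ⊢
  linarith

/-- The first-order conditions of a Nash equilibrium. -/
structure IsStationary (E : EnergyCommunity ι τ κ) (m : Profile G φ τ κ) : Prop where
  y_max : ∀ i y, E.netUtility i (m.qAvg i) (m.quotedPrice E i) y
    ≤ E.netUtility i (m.qAvg i) (m.quotedPrice E i) (m i).y
  q_eq : ∀ i l, ((m i).q l : ℝ) = max 0 (m.qAvg i l - m.slack E i l / 2)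
  s_eq : ∀ i t, ((m i).s t : ℝ) = max 0 (m.sAvg i t - (m.zPeak i - m.zeta i t) / 2)
  β_eq : ∀ i (j : {j : ι // φ j = i}), (m i).β j = (m j).y
  n_eq : ∀ i (j : G.neighborSet i), (m i).n j = m.fCon E i j
  ν_eq : ∀ i (j : G.neighborSet i), (m i).ν j = m.fPeak i j

theorem IsStationary.isNash (hφ : ∀ i, φ i ∈ G.neighborSet i) {E : EnergyCommunity ι τ κ}
    {m : Profile G φ τ κ} (h : m.IsStationary E) : m.IsNash E := by
  intro i mi
  have hmi : m i = m.reply E i := by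
    have hq : (m i).q = (m.reply E i).q := by
      funext l
      apply NNReal.coe_injective
      rw [h.q_eq]
      simp [reply]
    have hs : (m i).s = (m.reply E i).s := by
      funext t
      apply NNReal.coe_injective
      rw [h.s_eq]
      simp [reply]
    have hy : (m i).y = (m.reply E i).y := rfl
    have hβ : (m i).β = (m.reply E i).β := funext fun j => h.β_eq i j
    have hn : (m i).n = (m.reply E i).n := funext fun j => h.n_eq i j
    have hν : (m i).ν = (m.reply E i).ν := funext fun j => h.ν_eq i j
    generalize m.reply E i = r at *
    cases hm : m i
    cases r
    simp_all
  rw [payoff_update hφ, payoff_eq]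
  have h₁ := m.penalty_reply_add_le E i mi
  have h₂ : 0 ≤ ∑ l, (∑ j : G.neighborSet i, (mi.n j l - m.fCon E i j l) ^ 2
          + ((mi.q l : ℝ) - (m.reply E i).q l) ^ 2)
        + ∑ t, (∑ j : {j : ι // φ j = i}, (mi.β j t - (m j).y t) ^ 2
          + ∑ j : G.neighborSet i, (mi.ν j t - m.fPeak i j t) ^ 2
          + ((mi.s t : ℝ) - (m.reply E i).s t) ^ 2) := by positivity
  have h₃ := h.y_max i mi.y
  rw [← hmi] at h₁ h₂
  linarith

/-- Two deviations suffice: `reply` keeps the demand and so tests only the penalty, while changing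
`y` alone leaves the penalty untouched. -/
theorem IsNash.isStationary (hφ : ∀ i, φ i ∈ G.neighborSet i) {E : EnergyCommunity ι τ κ}
    {m : Profile G φ τ κ} (h : m.IsNash E) : m.IsStationary E := by
  have hdev : ∀ i, ∑ l, (∑ j : G.neighborSet i, ((m i).n j l - m.fCon E i j l) ^ 2
          + (((m i).q l : ℝ) - (m.reply E i).q l) ^ 2)
        + ∑ t, (∑ j : {j : ι // φ j = i}, ((m i).β j t - (m j).y t) ^ 2
          + ∑ j : G.neighborSet i, ((m i).ν j t - m.fPeak i j t) ^ 2
          + (((m i).s t : ℝ) - (m.reply E i).s t) ^ 2) ≤ 0 := fun i => by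
    have h₁ := h i (m.reply E i)
    rw [payoff_update hφ, payoff_eq] at h₁
    have h₂ := m.penalty_reply_add_le E i (m i)
    have h₃ : (m.reply E i).y = (m i).y := rfl
    rw [h₃] at h₁
    linarith
  have hκ : ∀ i l, ∑ j : G.neighborSet i, ((m i).n j l - m.fCon E i j l) ^ 2
          + (((m i).q l : ℝ) - (m.reply E i).q l) ^ 2 = 0 := fun i l => by
    have hsum := le_antisymm (le_trans (le_add_of_nonneg_right (by positivity)) (hdev i))
      (by positivity)
    exact (Finset.sum_eq_zero_iff_of_nonneg fun l _ => by positivity).1 hsum l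
      (Finset.mem_univ l)
  have hτ : ∀ i t, ∑ j : {j : ι // φ j = i}, ((m i).β j t - (m j).y t) ^ 2
          + ∑ j : G.neighborSet i, ((m i).ν j t - m.fPeak i j t) ^ 2
          + (((m i).s t : ℝ) - (m.reply E i).s t) ^ 2 = 0 := fun i t => by
    have hsum := le_antisymm (le_trans (le_add_of_nonneg_left (by positivity)) (hdev i))
      (by positivity)
    exact (Finset.sum_eq_zero_iff_of_nonneg fun t _ => by positivity).1 hsum t
      (Finset.mem_univ t)
  have hsq : ∀ {α : Type _} [Fintype α] {f g : α → ℝ}, ∑ j, (f j - g j) ^ 2 = 0 →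
      ∀ j, f j = g j := fun {α _ f g} h0 j => by
    have := (Finset.sum_eq_zero_iff_of_nonneg fun j _ => by positivity).1 h0 j (Finset.mem_univ j)
    exact sub_eq_zero.1 (pow_eq_zero_iff two_ne_zero |>.1 this)
  refine ⟨fun i y => ?_, fun i l => ?_, fun i t => ?_, fun i j => funext fun t => ?_,
    fun i j => funext fun l => ?_, fun i j => funext fun t => ?_⟩
  · have h₁ := h i { m i with y := y }
    rw [payoff_update hφ, payoff_eq] at h₁
    have h₂ : m.penalty E i { m i with y := y } = m.penalty E i (m i) := rfl
    rw [h₂] at h₁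
    linarith
  · have h₁ : (((m i).q l : ℝ) - (m.reply E i).q l) ^ 2 = 0 :=
      le_antisymm (by rw [← hκ i l]; exact le_add_of_nonneg_left (by positivity)) (by positivity)
    simpa [reply, sub_eq_zero] using h₁
  · have h₁ : (((m i).s t : ℝ) - (m.reply E i).s t) ^ 2 = 0 :=
      le_antisymm (by rw [← hτ i t]; exact le_add_of_nonneg_left (by positivity)) (by positivity)
    simpa [reply, sub_eq_zero] using h₁
  · refine hsq (f := fun j => (m i).β j t) (g := fun j : {j : ι // φ j = i} => (m j).y t) ?_ j
    refine le_antisymm ?_ (by positivity)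
    rw [← hτ i t, add_assoc]; exact le_add_of_nonneg_right (by positivity)
  · refine hsq (f := fun j => (m i).n j l) (g := fun j : G.neighborSet i => m.fCon E i j l) ?_ j
    refine le_antisymm ?_ (by positivity)
    rw [← hκ i l]; exact le_add_of_nonneg_right (by positivity)
  · refine hsq (f := fun j => (m i).ν j t) (g := fun j : G.neighborSet i => m.fPeak i j t) ?_ j
    refine le_antisymm ?_ (by positivity)
    rw [← hτ i t, add_assoc]
    exact le_add_of_nonneg_of_le (by positivity) (le_add_of_nonneg_right (by positivity))

/-! ### Equilibria on a tree and optimality -/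

/-- In a stationary profile on a tree, the demand quoted to each user is the total demand. -/
theorem IsStationary.zeta_eq (htree : G.IsTree) {E : EnergyCommunity ι τ κ}
    {m : Profile G φ τ κ} (h : m.IsStationary E) (i : ι) (t : τ) :
    m.zeta i t = ∑ k, m.alloc k t := by
  have hside : ∀ i (j : G.neighborSet i), (m i).ν j t = ∑ k ∈ G.side i j, m.alloc k t :=
    htree.eq_sum_side (fun k => m.alloc k t) (fun i j => (m i).ν j t) fun i j => by
      rw [h.ν_eq]; rfl
  rw [← htree.sum_side_add (fun k => m.alloc k t) i, zeta]
  congr 1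
  · refine Finset.sum_congr rfl fun j hj => ?_
    have hij : j ∈ G.neighborSet i := by simpa using hj
    rw [← hside i ⟨j, hij⟩, h.ν_eq]
  -- The sides of the neighbours omit `i` herself; the helper's proxy supplies her own demand.
  · rw [helperProxy, h.β_eq]; rfl

/-- In a stationary profile on a tree, the slack quoted to each user is the actual one. -/
theorem IsStationary.slack_eq (htree : G.IsTree) {E : EnergyCommunity ι τ κ}
    {m : Profile G φ τ κ} (h : m.IsStationary E) (i : ι) (l : κ) :
    m.slack E i l = E.b l - ∑ k, ∑ t, E.a k l t * m.alloc k t := by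
  have hside : ∀ i (j : G.neighborSet i),
      (m i).n j l = ∑ k ∈ G.side i j, ∑ t, E.a k l t * m.alloc k t :=
    htree.eq_sum_side (fun k => ∑ t, E.a k l t * m.alloc k t) (fun i j => (m i).n j l)
      fun i j => by rw [h.n_eq]; rfl
  rw [← htree.sum_side_add (fun k => ∑ t, E.a k l t * m.alloc k t) i, slack, sub_sub]
  congr 2
  · refine Finset.sum_congr rfl fun j hj => ?_
    have hij : j ∈ G.neighborSet i := by simpa using hj
    rw [← hside i ⟨j, hij⟩, h.n_eq]
  · refine Finset.sum_congr rfl fun t _ => ?_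
    rw [helperProxy, h.β_eq]; rfl

theorem IsStationary.isOptimalAllocation (htree : G.IsTree) (hφ : ∀ i, φ i ∈ G.neighborSet i)
    {E : EnergyCommunity ι τ κ} (hp : 0 ≤ E.peakPrice) {m : Profile G φ τ κ}
    (h : m.IsStationary E) : E.IsOptimalAllocation m.alloc := by
  obtain ⟨i₀⟩ := htree.connected.nonempty
  have hq := fun l => htree.connected.eq_of_eq_max_average (q := fun i => ((m i).q l : ℝ)) hφ
    fun i => by rw [h.q_eq, h.slack_eq htree]; rfl
  have hzeta : ∀ i, m.zeta i = fun t => ∑ k, m.alloc k t := fun i =>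
    funext fun t => h.zeta_eq htree i t
  have hs := fun t => htree.connected.eq_of_eq_max_average (q := fun i => ((m i).s t : ℝ)) hφ
    fun i => by rw [h.s_eq, zPeak, hzeta]; rfl
  have hqAvg : ∀ i, m.qAvg i = fun l => ((m i₀).q l : ℝ) := fun i => funext fun l =>
    (SimpleGraph.average_const (hq l).2.1 (hφ i)).trans ((hq l).2.1 i i₀)
  have hsAvg : ∀ i, m.sAvg i = fun t => ((m i₀).s t : ℝ) := fun i => funext fun t =>
    (SimpleGraph.average_const (hs t).2.1 (hφ i)).trans ((hs t).2.1 i i₀)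
  -- The dual prices are the quoted radial prices rather than `s`, whose total need not be `p₀`.
  -- Feasibility is the nonnegativity of the common slack.
  refine isOptimalAllocation_of_prices (q := m.qAvg i₀) (r := m.quotedPrice E i₀)
    (fun l => sub_nonneg.1 (hq l).1) (fun l => ?_) (fun t => ?_) (fun l => ?_) (fun t => ?_) ?_
    fun i y => ?_
  · rw [hqAvg]; exact NNReal.coe_nonneg _
  · rw [quotedPrice, hsAvg]; exact radialPrice_nonneg hp (fun t => NNReal.coe_nonneg _) _ _
  · rw [hqAvg]; exact (hq l).2.2 i₀
  · rw [quotedPrice, hsAvg, hzeta]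
    exact radialPrice_mul_slack (d := fun t => ∑ k, m.alloc k t) _ (fun t => (hs t).2.2 i₀) t
  · rw [quotedPrice, hsAvg]; exact sum_radialPrice _ (fun t => NNReal.coe_nonneg _) _
  · have := h.y_max i y
    rw [quotedPrice, hqAvg, hsAvg, hzeta] at this
    rw [quotedPrice, hqAvg, hsAvg, hzeta]
    exact this

/-- The profile in which everyone quotes the multipliers `q`, `s` and the exact aggregates of the
allocation `x`. -/
noncomputable def truthful (E : EnergyCommunity ι τ κ) (x : ι → τ → ℝ) (q : κ → ℝ) (s : τ → ℝ) :
    Profile G φ τ κ := fun i =>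
  { y := x i
    q := fun l => (q l).toNNReal
    s := fun t => (s t).toNNReal
    β := fun j => x j
    n := fun j l => ∑ k ∈ G.side i j, ∑ t, E.a k l t * x k t
    ν := fun j t => ∑ k ∈ G.side i j, x k t }

/-- Exact side sums solve the tree recursion, radial pricing returns `s` since its total is `p₀`,
and complementary slackness makes `q` and `s` fixed by the shift and cut-off. -/
theorem isStationary_truthful (htree : G.IsTree) (hφ : ∀ i, φ i ∈ G.neighborSet i)
    {E : EnergyCommunity ι τ κ} (hv : ∀ i t, Differentiable ℝ (E.v i t))
    (hconc : ∀ i t, ConcaveOn ℝ Set.univ (E.v i t)) {x : ι → τ → ℝ} (hx : x ∈ E.feasible)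
    {q : κ → ℝ} {s : τ → ℝ} (h : E.IsKKT x q s) :
    (truthful E x q s : Profile G φ τ κ).IsStationary E := by
  set m : Profile G φ τ κ := truthful E x q s with hm
  have hfPeak : ∀ i j, G.Adj i j → ∀ t, m.fPeak i j t = ∑ k ∈ G.side i j, x k t :=
    fun i j hij t => (htree.sum_side (fun k => x k t) hij).symm
  have hfCon : ∀ i j, G.Adj i j → ∀ l,
      m.fCon E i j l = ∑ k ∈ G.side i j, ∑ t, E.a k l t * x k t :=
    fun i j hij l => (htree.sum_side (fun k => ∑ t, E.a k l t * x k t) hij).symm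
  have hzeta : ∀ i, m.zeta i = fun t => ∑ k, x k t := fun i => funext fun t => by
    rw [← htree.sum_side_add (fun k => x k t) i, zeta]
    congr 1
    exact Finset.sum_congr rfl fun j hj => hfPeak i j (by simpa using hj) t
  have hslack : ∀ i l, m.slack E i l = E.b l - ∑ k, ∑ t, E.a k l t * x k t := fun i l => by
    rw [← htree.sum_side_add (fun k => ∑ t, E.a k l t * x k t) i, slack, sub_sub]
    congr 2
    exact Finset.sum_congr rfl fun j hj => hfCon i j (by simpa using hj) l
  have hmq : ∀ i l, ((m i).q l : ℝ) = q l := fun i l => Real.coe_toNNReal _ (h.q_nonneg l)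
  have hms : ∀ i t, ((m i).s t : ℝ) = s t := fun i t => Real.coe_toNNReal _ (h.s_nonneg t)
  have hqAvg : ∀ i, m.qAvg i = q := fun i => funext fun l => by
    rw [qAvg, Finset.sum_congr rfl fun j _ => hmq j l]
    exact SimpleGraph.average_const (q := fun _ => q l) (fun _ _ => rfl) (hφ i)
  have hsAvg : ∀ i, m.sAvg i = s := fun i => funext fun t => by
    rw [sAvg, Finset.sum_congr rfl fun j _ => hms j t]
    exact SimpleGraph.average_const (q := fun _ => s t) (fun _ _ => rfl) (hφ i)
  have hprice : ∀ i, m.quotedPrice E i = s := fun i => funext fun t => by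
    rw [quotedPrice, hsAvg]
    exact radialPrice_eq_self h.s_nonneg h.sum_s _ t
  have hmax : ∀ {c w : ℝ}, 0 ≤ c → 0 ≤ w → c * w = 0 → c = max 0 (c - w / 2) := by
    intro c w hc hw hcw
    rcases mul_eq_zero.1 hcw with rfl | rfl
    · rw [max_eq_left (by linarith)]
    · rw [zero_div, sub_zero, max_eq_right hc]
  refine ⟨fun i y => ?_, fun i l => ?_, fun i t => ?_, fun i j => rfl,
    fun i j => funext fun l => (hfCon i j j.2 l).symm,
    fun i j => funext fun t => (hfPeak i j j.2 t).symm⟩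
  · rw [hqAvg, hprice]
    exact h.netUtility_le hv hconc i y
  · rw [hmq, hqAvg, hslack]
    exact hmax (h.q_nonneg l) (sub_nonneg.2 (hx l)) (h.q_slack l)
  · rw [hms, hsAvg, zPeak, hzeta]
    exact hmax (h.s_nonneg t) (sub_nonneg.2 (le_peak (fun t => ∑ k, x k t) t)) (h.s_slack t)

end Profile

theorem theorem5 {ι τ κ : Type*} [Fintype ι] [DecidableEq ι] [Fintype τ] [Nonempty τ] [Fintype κ]
    (E : EnergyCommunity ι τ κ)
    (hv : ∀ i t, Differentiable ℝ (E.v i t) ∧ Differentiable ℝ (deriv (E.v i t)))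
    (hconc : ∀ i t, StrictConcaveOn ℝ Set.univ (E.v i t))
    (hp : 0 ≤ E.peakPrice)
    (hne : E.feasible.Nonempty) (hbdd : Bornology.IsBounded E.feasible)
    -- the message exchange network, a spanning tree of it, and the helpers
    (GR : SimpleGraph ι) (hGR : GR.Connected)
    (G : SimpleGraph ι) [DecidableRel G.Adj] (hG : G ≤ GR) (htree : G.IsTree)
    (φ : ι → ι) (hφ : ∀ i, φ i ∈ G.neighborSet i) :
    (∃! x, E.IsOptimalAllocation x) ∧
      (∃ m : Profile G φ τ κ, m.IsNash E) ∧
      ∀ m : Profile G φ τ κ, m.IsNash E → E.IsOptimalAllocation m.alloc := by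
  obtain ⟨x, hx⟩ := E.exists_isOptimalAllocation (fun i t => (hv i t).1.continuous) hne hbdd
  obtain ⟨q, s, hqs⟩ := hx.exists_isKKT (fun i t => (hv i t).1) hp
  refine ⟨⟨x, hx, fun y hy => hy.unique hconc hp hx⟩, ⟨Profile.truthful E x q s, ?_⟩,
    fun m hm => (hm.isStationary hφ).isOptimalAllocation htree hφ hp⟩
  exact (Profile.isStationary_truthful htree hφ (fun i t => (hv i t).1)
    (fun i t => (hconc i t).concaveOn) hx.1 hqs).isNash hφ
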